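/- Let $G$ be a finite group, let $X$ be a finite homogeneous $G$-set (a non-empty finite set with a transitive action of $G$), let $m\ge 1$, and let $Q_1,\dots,Q_m$ be probability distributions on $G$. For a word $w=w_1w_2\dots w_N$ with letters $w_i\in\{1,\dots,m\}$ let $Q^{(w)}:=Q_{w_1}\ast\dots\ast Q_{w_N}$, where $(P\ast Q)(h)=\sum_{g\in G}P(hg^{-1})Q(g)$, and let $q^{(w)}:=\sum_{g\in G}Q^{(w)}(g)e_g\in\mathbb{C}G$. Let $\mathbb{C}X$ be the permutation module with basis $\{e_x\}_{x\in X}$ and $e_g\cdot e_x=e_{gx}$, let $\overline{u}:=\frac{1}{|X|}\sum_{x\in X}e_x$, and let $\|h\|_{\rm TV}:=\frac12\sum_{x\in X}|h(x)|$ for $h=\sum_x h(x)e_x\in\mathbb{C}X$. For an irreducible complex representation $\rho$ of $G$, written as unitary matrices in an orthonormal basis for an invariant inner product, let $\widehat{Q}(\rho):=\sum_{g\in G}Q(g)\rho(g)$. The joint spectral radius of complex $n\times n$ matrices $A_1,\dots,A_m$ is \[{\rm jsr}(A_1,\dots,A_m):=\lim_{N\to\infty}\max_{|w|=N}\|A_{w_1}\cdots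 A_{w_N}\|^{1/N},\] where $\|\cdot\|$ is the Frobenius norm. The Fourier joint spectral radius of $Q_1,\dots,Q_m$ relative to $X$ is \[\overline{\omega}_X(Q_1,\dots,Q_m):=\max_{\rho}\ {\rm jsr}\big(\widehat{Q_1}(\rho),\dots,\widehat{Q_m}(\rho)\big),\] the maximum being over the nontrivial irreducible representations $\rho$ of $G$ that appear with nonzero multiplicity in $\mathbb{C}X$ (and $\overline{\omega}_X:=0$ if there are none). The distributions have the adversarial mixing property on $X$ if $\max_{x_0\in X,\,|w|=N}\|q^{(w)}\cdot e_{x_0}-\overline{u}\|_{\rm TV}\to 0$ as $N\to\infty$. Theorem. The limits defining the joint spectral radii in $\overline{\omega}_X(Q_1,\dots,Q_m)$ exist; if at least one nontrivial irreducible representation appears in $\mathbb{C}X$, the maximum is attained; and \[\lim_{N\to\infty}\Big(\max_{x_0\in X,\ |w|=N}\|q^{(w)}\cdot e_{x_0}-\overline{u}\|_{\rm TV}\Big)^{1/N}=\overline{\omega}_X(Q_1,\dots,Q_m).\] Furthermore, $Q_1,\dots,Q_m$ have the adversarial mixing property on $X$ if and only if $\overline{\omega}_X(Q_1,\dots,Q_m)<1$.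 -/

import Mathlib

open Filter Topology

noncomputable section

namespace SwitchedWalk

/-! ### Distributions on a finite group and the permutation module -/

section Walk

variable {G : Type*} [Group G] [Fintype G]

/-- The convolution `(P * Q)(h) = ∑ g, P (h g⁻¹) Q g` of two functions on `G`. -/
def conv (P Q : G → ℝ) : G → ℝ :=
  fun h => ∑ g, P (h * g⁻¹) * Q g

/-- The convolution `Q_{w₁} * ⋯ * Q_{w_N}` along a word `w` of length `N`
(the point mass at the identity, if `N = 0`). -/
def wordConv {m : ℕ} (Q : Fin m → G → ℝ) {N : ℕ} (w : Fin N → Fin m) : G → ℝ :=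
  (List.ofFn fun k => Q (w k)).foldr conv (Set.indicator {1} 1)

/-- The element `∑ g, Q g • e_g` of the group algebra `ℂG`. -/
def toGroupAlgebra (Q : G → ℝ) : MonoidAlgebra ℂ G :=
  ∑ g, MonoidAlgebra.single g (Q g : ℂ)

variable {X : Type*} [Fintype X] [MulAction G X]

/-- The product `q · v` of an element of `ℂG` and an element of the permutation module `ℂX`. -/
def act (q : MonoidAlgebra ℂ G) (v : MonoidAlgebra ℂ X) : MonoidAlgebra ℂ X :=
  (Representation.ofMulAction ℂ G X).asAlgebraHom q v

variable (X) in
/-- The uniform distribution `(1 / |X|) ∑ x, e_x` in `ℂX`. -/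
def uniform : MonoidAlgebra ℂ X :=
  ∑ x : X, MonoidAlgebra.single x (1 / (Fintype.card X : ℂ))

/-- The total variation norm `½ ∑ x, |h x|` on `ℂX`. -/
def tvNorm (h : MonoidAlgebra ℂ X) : ℝ :=
  1 / 2 * ∑ x, ‖h.coeff x‖

variable (X) in
/-- The largest total variation distance to uniform, over all initial states and all words
of length `N`. -/
def worstTV {m : ℕ} (Q : Fin m → G → ℝ) (N : ℕ) : ℝ :=
  ⨆ p : X × (Fin N → Fin m),
    tvNorm (act (toGroupAlgebra (wordConv Q p.2)) (MonoidAlgebra.single p.1 1) - uniform X)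

variable (X) in
/-- The adversarial mixing property on `X`: the switched random walk converges to the uniform
distribution, whatever the initial state and the order in which the distributions are used. -/
def AdversarialMixing {m : ℕ} (Q : Fin m → G → ℝ) : Prop :=
  Tendsto (worstTV X Q) atTop (𝓝 0)

end Walk

/-! ### The joint spectral radius -/

section JSR

attribute [local instance] Matrix.frobeniusNormedAddCommGroup

/-- `max_{|w| = N} ‖A_{w₁} ⋯ A_{w_N}‖ ^ (1 / N)`, for the Frobenius norm. -/
def jsrSeq {m n : ℕ} (A : Fin m → Matrix (Fin n) (Fin n) ℂ) (N : ℕ) : ℝ :=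
  ⨆ w : Fin N → Fin m, ‖(List.ofFn fun k => A (w k)).prod‖ ^ (1 / (N : ℝ))

/-- The joint spectral radius of a finite family of complex matrices. -/
def jsr {m n : ℕ} (A : Fin m → Matrix (Fin n) (Fin n) ℂ) : ℝ :=
  limUnder atTop (jsrSeq A)

end JSR

/-! ### Fourier transforms and the Fourier joint spectral radius -/

section Fourier

variable {G : Type*} [Group G] {n : ℕ}

/-- The representation on `ℂⁿ` given by a homomorphism into the unitary matrices. -/
def toRep (ρ : G →* Matrix.unitaryGroup (Fin n) ℂ) : Representation ℂ G (Fin n → ℂ) where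
  toFun g := (ρ g : Matrix (Fin n) (Fin n) ℂ).mulVecLin
  map_one' := by simp [Module.End.one_eq_id]
  map_mul' g h := by simp [Matrix.mulVecLin_mul, Module.End.mul_eq_comp]

/-- The Fourier transform `∑ g, Q g • ρ g` of `Q` at a unitary matrix representation `ρ`. -/
def fourierTransform [Fintype G] (Q : G → ℝ) (ρ : G →* Matrix.unitaryGroup (Fin n) ℂ) :
    Matrix (Fin n) (Fin n) ℂ :=
  ∑ g, (Q g : ℂ) • (ρ g : Matrix (Fin n) (Fin n) ℂ)

/-- `ρ` is a nontrivial irreducible representation that appears in `ℂX`, that is, one isomorphic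
to a subrepresentation of `ℂX`. (By complete reducibility, these are the irreducible
representations of nonzero multiplicity in `ℂX`.) -/
structure IsNontrivialConstituent (X : Type*) [MulAction G X]
    (ρ : G →* Matrix.unitaryGroup (Fin n) ℂ) : Prop where
  irreducible : (toRep ρ).IsIrreducible
  nontrivial : ¬ (toRep ρ).IsTrivial
  appears : ∃ f : (toRep ρ).IntertwiningMap (Representation.ofMulAction ℂ G X),
    Function.Injective f

/-- The joint spectral radii of the Fourier transforms of `Q₁, …, Q_m` at the nontrivial
irreducible representations (written in orthonormal bases, as unitary matrices)
that appear in `ℂX`. -/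
def constituentRadii [Fintype G] (X : Type*) [MulAction G X] {m : ℕ} (Q : Fin m → G → ℝ) :
    Set ℝ :=
  {r | ∃ (n : ℕ) (ρ : G →* Matrix.unitaryGroup (Fin n) ℂ), IsNontrivialConstituent X ρ ∧
    r = jsr fun i => fourierTransform (Q i) ρ}

/-- The Fourier joint spectral radius of `Q₁, …, Q_m` relative to `X` (it is `0` if no nontrivial
irreducible representation appears in `ℂX`). -/
def fourierJSR [Fintype G] (X : Type*) [MulAction G X] {m : ℕ} (Q : Fin m → G → ℝ) : ℝ :=
  sSup (constituentRadii X Q)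

end Fourier

end SwitchedWalk

end

/-! By Maschke's theorem `ℂX` is the sum of its irreducible subrepresentations. By transitivity the
trivial ones contain only multiples of the uniform vector, which every word fixes. On a copy of a
nontrivial constituent `ρ` the augmentation vanishes and a word acts by the product of the matrices
`fourierTransform (Q i) ρ`. Up to constants independent of the word, the distance to uniform is
therefore governed by the norms of these products.

Upper bound: `exists_tvNorm_act_le` and `decaysAtRadii` lead to `exists_worstTV_le`, which gives
`O(s ^ N)` for every `s > M`, where `M` is zero or a constituent radius. Lower bound:
`exists_norm_fourierTransform_le`, with Fekete's inequality in `jsr_spec`, gives `r ^ N =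
O(worstTV)` for every radius `r` (`exists_pow_le_worstTV`). Taking `N`-th roots removes the
constants, so the limit is `M` and no radius exceeds it. -/

noncomputable section

namespace SwitchedWalk

/-! ### Growth rates of sequences -/

section Growth

/-- `c ^ (1 / N) → 1` for every positive constant `c`. -/
lemma tendsto_const_rpow_one_div {c : ℝ} (hc : 0 < c) :
    Tendsto (fun N : ℕ => c ^ (1 / (N : ℝ))) atTop (𝓝 1) := by
  have h : Tendsto (fun N : ℕ => c ^ (1 / (N : ℝ))) atTop (𝓝 (c ^ (0 : ℝ))) :=
    tendsto_const_nhds.rpow tendsto_one_div_atTop_nhds_zero_nat (Or.inl hc.ne')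
  rwa [Real.rpow_zero] at h

lemma mul_pow_rpow_one_div {c s : ℝ} (hc : 0 ≤ c) (hs : 0 ≤ s) {N : ℕ} (hN : N ≠ 0) :
    (c * s ^ N) ^ (1 / (N : ℝ)) = c ^ (1 / (N : ℝ)) * s := by
  rw [Real.mul_rpow hc (by positivity), one_div, Real.pow_rpow_inv_natCast hs hN]

/-- A criterion for convergence of the `N`-th roots of a nonnegative sequence. -/
lemma tendsto_rpow_one_div_of_bounds {x : ℕ → ℝ} (hx : ∀ N, 0 ≤ x N) {M : ℝ} (hM : 0 ≤ M)
    (hlow : M = 0 ∨ ∃ C, ∀ N, N ≠ 0 → M ^ N ≤ C * x N)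
    (hup : ∀ s, M < s → ∃ C, ∀ᶠ N in atTop, x N ≤ C * s ^ N) :
    Tendsto (fun N : ℕ => x N ^ (1 / (N : ℝ))) atTop (𝓝 M) := by
  refine tendsto_order.2 ⟨fun a ha => ?_, fun b hb => ?_⟩
  · rcases hlow with rfl | ⟨C, hlow⟩
    · exact Eventually.of_forall fun N => ha.trans_le (Real.rpow_nonneg (hx N) _)
    -- `C` itself could be nonpositive; the root of `max C 1` tends to `1`.
    have hC : 0 < max C 1 := by positivity
    have h : Tendsto (fun N : ℕ => (max C 1)⁻¹ ^ (1 / (N : ℝ)) * M) atTop (𝓝 (1 * M)) :=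
      (tendsto_const_rpow_one_div (inv_pos.2 hC)).mul_const M
    rw [one_mul] at h
    filter_upwards [h.eventually_const_lt ha, eventually_ne_atTop 0] with N hN hN0
    refine hN.trans_le ?_
    rw [← mul_pow_rpow_one_div (inv_pos.2 hC).le hM hN0]
    refine Real.rpow_le_rpow (by positivity) ?_ (by positivity)
    rw [inv_mul_le_iff₀ hC]
    exact (hlow N hN0).trans (mul_le_mul_of_nonneg_right (le_max_left _ _) (hx N))
  · obtain ⟨s, hs, hsb⟩ := exists_between hb
    obtain ⟨C, hC⟩ := hup s hs
    have hs0 : 0 ≤ s := hM.trans hs.le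
    have h : Tendsto (fun N : ℕ => (max C 1) ^ (1 / (N : ℝ)) * s) atTop (𝓝 (1 * s)) :=
      (tendsto_const_rpow_one_div (by positivity)).mul_const s
    rw [one_mul] at h
    filter_upwards [h.eventually_lt_const hsb, eventually_ne_atTop 0, hC] with N hN hN0 hCN
    refine lt_of_le_of_lt ?_ hN
    rw [← mul_pow_rpow_one_div (by positivity) hs0 hN0]
    refine Real.rpow_le_rpow (hx N) (hCN.trans ?_) (by positivity)
    gcongr
    exact le_max_left _ _

/-- If `r ^ N = O(x N)`, then `r` is at most the limit of the `N`-th roots of `x N`. -/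
lemma le_of_pow_le_of_tendsto_rpow_one_div {x : ℕ → ℝ} (hx : ∀ N, 0 ≤ x N) {M r C : ℝ}
    (hr : 0 ≤ r) (hlow : ∀ N, N ≠ 0 → r ^ N ≤ C * x N)
    (hlim : Tendsto (fun N : ℕ => x N ^ (1 / (N : ℝ))) atTop (𝓝 M)) : r ≤ M := by
  have hC : 0 < max C 1 := by positivity
  have h := (tendsto_const_rpow_one_div hC).mul hlim
  rw [one_mul] at h
  refine ge_of_tendsto h ?_
  filter_upwards [eventually_ne_atTop 0] with N hN
  calc r = (r ^ N) ^ (1 / (N : ℝ)) := by rw [one_div, Real.pow_rpow_inv_natCast hr hN]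
    _ ≤ (max C 1 * x N) ^ (1 / (N : ℝ)) := by
      refine Real.rpow_le_rpow (by positivity) ((hlow N hN).trans ?_) (by positivity)
      exact mul_le_mul_of_nonneg_right (le_max_left _ _) (hx N)
    _ = (max C 1) ^ (1 / (N : ℝ)) * x N ^ (1 / (N : ℝ)) := Real.mul_rpow hC.le (hx N)

/-- Iterating submultiplicativity. -/
lemma submul_mul_add_le {u : ℕ → ℝ} (hu : ∀ n, 0 ≤ u n) (hmul : ∀ m n, u (m + n) ≤ u m * u n)
    (k n r : ℕ) : u (k * n + r) ≤ u n ^ k * u r := by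
  induction k with
  | zero => simp
  | succ k ih =>
    calc u ((k + 1) * n + r) = u (n + (k * n + r)) := by congr 1; ring
      _ ≤ u n * (u n ^ k * u r) := (hmul _ _).trans (mul_le_mul_of_nonneg_left ih (hu n))
      _ = u n ^ (k + 1) * u r := by ring

/-- If `u n ≤ t ^ n` for one `n ≥ 1`, then a submultiplicative sequence `u` grows at most
like `t ^ N`. -/
lemma submul_le_const_mul_pow {u : ℕ → ℝ} (hu : ∀ n, 0 ≤ u n)
    (hmul : ∀ m n, u (m + n) ≤ u m * u n) {t : ℝ} (ht : 0 < t) {n : ℕ} (hn : n ≠ 0)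
    (hnt : u n ≤ t ^ n) : ∃ C, ∀ N, u N ≤ C * t ^ N := by
  -- Dividing `N` by `n` leaves a remainder `r < n`, which costs a factor `u r / t ^ r`; the sum
  -- dominates all of them.
  refine ⟨∑ r ∈ Finset.range n, u r / t ^ r, fun N => ?_⟩
  have hr : N % n < n := Nat.mod_lt _ (Nat.pos_of_ne_zero hn)
  calc u N = u (N / n * n + N % n) := by rw [Nat.div_add_mod']
    _ ≤ u n ^ (N / n) * u (N % n) := submul_mul_add_le hu hmul _ _ _
    _ ≤ (t ^ n) ^ (N / n) * u (N % n) := by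
      gcongr
      · exact hu _
      · exact hu _
    _ = u (N % n) / t ^ (N % n) * t ^ N := by
      have : t ^ N = (t ^ n) ^ (N / n) * t ^ (N % n) := by
        rw [← pow_mul, ← pow_add, Nat.div_add_mod]
      rw [this]
      field_simp
    _ ≤ _ := by
      gcongr
      exact Finset.single_le_sum (f := fun r => u r / t ^ r)
        (fun r _ => div_nonneg (hu r) (by positivity)) (Finset.mem_range.2 hr)

/-- Fekete's lemma for nonnegative submultiplicative sequences. -/
lemma exists_tendsto_rpow_one_div_of_submul {u : ℕ → ℝ} (hu : ∀ n, 0 ≤ u n)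
    (hmul : ∀ m n, u (m + n) ≤ u m * u n) :
    ∃ L, 0 ≤ L ∧ Tendsto (fun N : ℕ => u N ^ (1 / (N : ℝ))) atTop (𝓝 L) ∧
      ∀ N, N ≠ 0 → L ^ N ≤ u N := by
  set S : Set ℝ := {t | 0 ≤ t ∧ ∃ n, n ≠ 0 ∧ u n ≤ t ^ n} with hS
  have hbdd : BddBelow S := ⟨0, fun t ht => ht.1⟩
  have hmem : ∀ N, N ≠ 0 → u N ^ (1 / (N : ℝ)) ∈ S := fun N hN =>
    ⟨Real.rpow_nonneg (hu N) _, N, hN, by rw [one_div, Real.rpow_inv_natCast_pow (hu N) hN]⟩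
  have hL : 0 ≤ sInf S := Real.sInf_nonneg fun t ht => ht.1
  have hpow : ∀ N, N ≠ 0 → sInf S ^ N ≤ u N := fun N hN => by
    calc sInf S ^ N ≤ (u N ^ (1 / (N : ℝ))) ^ N := by
          gcongr
          exact csInf_le hbdd (hmem N hN)
      _ = u N := by rw [one_div, Real.rpow_inv_natCast_pow (hu N) hN]
  refine ⟨sInf S, hL, ?_, hpow⟩
  refine tendsto_order.2 ⟨fun a ha => ?_, fun b hb => ?_⟩
  · filter_upwards [eventually_ne_atTop 0] with N hN
    exact ha.trans_le (csInf_le hbdd (hmem N hN))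
  · obtain ⟨t, ⟨ht0, n, hn, hnt⟩, htb⟩ := exists_lt_of_csInf_lt ⟨_, hmem 1 one_ne_zero⟩ hb
    -- `t` may be `0`, while the growth bound divides by powers of the rate; hence a larger `s > 0`.
    obtain ⟨s, hts, hsb⟩ := exists_between htb
    have hs : 0 < s := ht0.trans_lt hts
    obtain ⟨C, hC⟩ := submul_le_const_mul_pow hu hmul hs hn
      (hnt.trans (pow_le_pow_left₀ ht0 hts.le n))
    have h : Tendsto (fun N : ℕ => (max C 1) ^ (1 / (N : ℝ)) * s) atTop (𝓝 (1 * s)) :=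
      (tendsto_const_rpow_one_div (by positivity)).mul_const s
    rw [one_mul] at h
    filter_upwards [h.eventually_lt_const hsb, eventually_ne_atTop 0] with N hN hN0
    refine lt_of_le_of_lt ?_ hN
    rw [← mul_pow_rpow_one_div (by positivity) hs.le hN0]
    refine Real.rpow_le_rpow (hu N) ((hC N).trans ?_) (by positivity)
    gcongr
    exact le_max_left _ _

end Growth

/-! ### Existence of the joint spectral radius -/

section JSR

attribute [local instance] Matrix.frobeniusNormedAddCommGroup

variable {m n : ℕ} (A : Fin m → Matrix (Fin n) (Fin n) ℂ)

/-- `max_{|w| = N} ‖A_{w₁} ⋯ A_{w_N}‖`, for the Frobenius norm. -/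
def maxNorm (N : ℕ) : ℝ :=
  ⨆ w : Fin N → Fin m, ‖(List.ofFn fun k => A (w k)).prod‖

lemma norm_prod_le_maxNorm {N : ℕ} (w : Fin N → Fin m) :
    ‖(List.ofFn fun k => A (w k)).prod‖ ≤ maxNorm A N :=
  le_ciSup (f := fun w : Fin N → Fin m => ‖(List.ofFn fun k => A (w k)).prod‖)
    (Set.finite_range _).bddAbove w

lemma maxNorm_nonneg (N : ℕ) : 0 ≤ maxNorm A N :=
  Real.iSup_nonneg fun _ => norm_nonneg _

lemma maxNorm_add_le [NeZero m] (M N : ℕ) : maxNorm A (M + N) ≤ maxNorm A M * maxNorm A N := by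
  refine ciSup_le fun w => ?_
  have h : (List.ofFn fun k => A (w k)) = (List.ofFn fun k => A (w (Fin.castAdd N k))) ++
      (List.ofFn fun k => A (w (Fin.natAdd M k))) := by
    rw [← List.ofFn_fin_append]
    congr 1
    ext k : 1
    refine Fin.addCases (fun k => ?_) (fun k => ?_) k <;> simp
  rw [h, List.prod_append]
  exact (Matrix.frobenius_norm_mul _ _).trans
    (mul_le_mul (norm_prod_le_maxNorm A fun k => w (Fin.castAdd N k))
      (norm_prod_le_maxNorm A fun k => w (Fin.natAdd M k)) (norm_nonneg _) (maxNorm_nonneg A M))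

/-- The root is monotone and the maximum over the finitely many words is attained, so the two
commute. -/
lemma jsrSeq_eq [NeZero m] (N : ℕ) : jsrSeq A N = maxNorm A N ^ (1 / (N : ℝ)) := by
  apply le_antisymm
  · exact ciSup_le fun w => Real.rpow_le_rpow (norm_nonneg _) (norm_prod_le_maxNorm A w)
      (by positivity)
  · obtain ⟨w, hw⟩ := exists_eq_ciSup_of_finite
      (f := fun w : Fin N → Fin m => ‖(List.ofFn fun k => A (w k)).prod‖)
    rw [maxNorm, ← hw]
    exact le_ciSup (f := fun w : Fin N → Fin m =>
      ‖(List.ofFn fun k => A (w k)).prod‖ ^ (1 / (N : ℝ))) (Set.finite_range _).bddAbove w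

lemma jsr_spec [NeZero m] : 0 ≤ jsr A ∧ Tendsto (jsrSeq A) atTop (𝓝 (jsr A)) ∧
    ∀ N, N ≠ 0 → jsr A ^ N ≤ maxNorm A N := by
  obtain ⟨L, hL, hT, hp⟩ := exists_tendsto_rpow_one_div_of_submul (maxNorm_nonneg A)
    (maxNorm_add_le A)
  have hT' : Tendsto (jsrSeq A) atTop (𝓝 L) := by
    rwa [show jsrSeq A = fun N : ℕ => maxNorm A N ^ (1 / (N : ℝ)) from funext (jsrSeq_eq A)]
  have h : jsr A = L := hT'.limUnder_eq
  rw [h]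
  exact ⟨hL, hT', hp⟩

lemma maxNorm_le_pow_of_jsr_lt [NeZero m] {s : ℝ} (hs : jsr A < s) :
    ∀ᶠ N in atTop, maxNorm A N ≤ s ^ N := by
  filter_upwards [(jsr_spec A).2.1.eventually_lt_const hs, eventually_ne_atTop 0] with N hN hN0
  rw [jsrSeq_eq] at hN
  calc maxNorm A N = (maxNorm A N ^ (1 / (N : ℝ))) ^ N := by
        rw [one_div, Real.rpow_inv_natCast_pow (maxNorm_nonneg A N) hN0]
    _ ≤ s ^ N := pow_le_pow_left₀ (Real.rpow_nonneg (maxNorm_nonneg A N) _) hN.le N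

end JSR

/-! ### Words, Fourier transforms and the permutation module -/

section Words

variable {G : Type*} [Group G] [Fintype G]

lemma sum_conv (P Q : G → ℝ) : ∑ h, conv P Q h = (∑ g, P g) * ∑ g, Q g := by
  simp only [conv]
  rw [Finset.sum_comm, Finset.mul_sum]
  refine Finset.sum_congr rfl fun g _ => ?_
  rw [← Finset.sum_mul]
  exact congrArg (· * Q g) (Equiv.sum_comp (Equiv.mulRight g⁻¹) P)

lemma sum_wordConv {m : ℕ} {Q : Fin m → G → ℝ} (hQ : ∀ i, ∑ g, Q i g = 1) {N : ℕ}
    (w : Fin N → Fin m) : ∑ g, wordConv Q w g = 1 := by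
  classical
  induction N with
  | zero => simp [wordConv]
  | succ N ih =>
    have h : wordConv Q w = conv (Q (w 0)) (wordConv Q fun k => w k.succ) := by
      simp [wordConv, List.ofFn_succ]
    rw [h, sum_conv, hQ, ih, one_mul]

variable {n : ℕ} (ρ : G →* Matrix.unitaryGroup (Fin n) ℂ)

lemma fourierTransform_conv (P Q : G → ℝ) :
    fourierTransform (conv P Q) ρ = fourierTransform P ρ * fourierTransform Q ρ := by
  simp only [fourierTransform, conv, Complex.ofReal_sum, Finset.sum_smul]
  rw [Finset.sum_comm, Finset.mul_sum]
  refine Finset.sum_congr rfl fun g _ => ?_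
  rw [Finset.sum_mul, ← Equiv.sum_comp (Equiv.mulRight g)]
  refine Finset.sum_congr rfl fun h _ => ?_
  simp only [Equiv.coe_mulRight, mul_inv_cancel_right, map_mul, Submonoid.coe_mul,
    smul_mul_smul_comm, Complex.ofReal_mul]

lemma fourierTransform_wordConv {m : ℕ} (Q : Fin m → G → ℝ) {N : ℕ} (w : Fin N → Fin m) :
    fourierTransform (wordConv Q w) ρ =
      (List.ofFn fun k => fourierTransform (Q (w k)) ρ).prod := by
  classical
  induction N with
  | zero =>
    simp [wordConv, fourierTransform]
  | succ N ih =>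
    have h : wordConv Q w = conv (Q (w 0)) (wordConv Q fun k => w k.succ) := by
      simp [wordConv, List.ofFn_succ]
    rw [h, fourierTransform_conv, ih, List.ofFn_succ, List.prod_cons]

variable {X : Type*} [MulAction G X]

lemma act_toGroupAlgebra (R : G → ℝ) (v : MonoidAlgebra ℂ X) :
    act (toGroupAlgebra R) v = ∑ g, (R g : ℂ) • Representation.ofMulAction ℂ G X g v := by
  simp [act, toGroupAlgebra, LinearMap.sum_apply]

lemma fourierTransform_mulVec (R : G → ℝ) (z : Fin n → ℂ) :
    (fourierTransform R ρ).mulVec z = ∑ g, (R g : ℂ) • toRep ρ g z := by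
  simp [fourierTransform, Matrix.sum_mulVec, Matrix.smul_mulVec, toRep]

/-- The bridge between matrix products and the walk on `X`. -/
lemma map_fourierTransform_mulVec
    (f : (toRep ρ).IntertwiningMap (Representation.ofMulAction ℂ G X)) (R : G → ℝ)
    (z : Fin n → ℂ) : f ((fourierTransform R ρ).mulVec z) = act (toGroupAlgebra R) (f z) := by
  rw [fourierTransform_mulVec, act_toGroupAlgebra, map_sum]
  refine Finset.sum_congr rfl fun g _ => ?_
  rw [map_smul, f.isIntertwining]

end Words

/-! ### The permutation module: invariant vectors and the total variation norm. -/

section Permutation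

variable {G X : Type*} [Group G] [MulAction G X] [Fintype X]

variable (X) in
/-- The identification of the permutation module with the functions on `X`. -/
def coords : MonoidAlgebra ℂ X ≃ₗ[ℂ] (X → ℂ) :=
  (MonoidAlgebra.coeffLinearEquiv ℂ).trans (Finsupp.linearEquivFunOnFinite ℂ ℂ X)

@[simp] lemma coords_apply (v : MonoidAlgebra ℂ X) (x : X) : coords X v x = v.coeff x := rfl

variable (X) in
/-- The augmentation, the sum of the coefficients. -/
def augmentation : MonoidAlgebra ℂ X →ₗ[ℂ] ℂ :=
  (∑ x, LinearMap.proj x) ∘ₗ (coords X).toLinearMap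

lemma augmentation_apply (v : MonoidAlgebra ℂ X) : augmentation X v = ∑ x, v.coeff x := by
  simp [augmentation]

omit [Fintype X] in
@[simp] lemma coeff_ofMulAction_apply (g : G) (v : MonoidAlgebra ℂ X) (x : X) :
    (Representation.ofMulAction ℂ G X g v).coeff x = v.coeff (g⁻¹ • x) :=
  Representation.coeff_ofMulAction g v x

lemma augmentation_ofMulAction (g : G) (v : MonoidAlgebra ℂ X) :
    augmentation X (Representation.ofMulAction ℂ G X g v) = augmentation X v := by
  simp only [augmentation_apply, coeff_ofMulAction_apply]
  exact Equiv.sum_comp (MulAction.toPerm g⁻¹) fun x => v.coeff x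

lemma coeff_uniform (x : X) : (uniform X).coeff x = 1 / (Fintype.card X : ℂ) := by
  classical
  simp [uniform, MonoidAlgebra.coeff_sum, Finsupp.single_apply]

lemma ofMulAction_uniform (g : G) :
    Representation.ofMulAction ℂ G X g (uniform X) = uniform X := by
  apply (coords X).injective
  ext x
  simp [coeff_uniform]

lemma act_uniform [Fintype G] {R : G → ℝ} (hR : ∑ g, R g = 1) :
    act (toGroupAlgebra R) (uniform X) = uniform X := by
  rw [act_toGroupAlgebra]
  simp only [ofMulAction_uniform]
  rw [← Finset.sum_smul, ← Complex.ofReal_sum, hR, Complex.ofReal_one, one_smul]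

/-- The invariant elements of the permutation module of a transitive action are the multiples of
the uniform distribution. -/
lemma eq_augmentation_smul_uniform [MulAction.IsPretransitive G X] {v : MonoidAlgebra ℂ X}
    (hv : ∀ g : G, Representation.ofMulAction ℂ G X g v = v) :
    v = augmentation X v • uniform X := by
  apply (coords X).injective
  ext x
  have hcard : (Fintype.card X : ℂ) ≠ 0 := by
    have : Nonempty X := ⟨x⟩
    simp
  have hc : ∀ y, v.coeff y = v.coeff x := fun y => by
    obtain ⟨g, rfl⟩ := MulAction.exists_smul_eq G x y
    conv_lhs => rw [← hv g]
    simp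
  simp [coeff_uniform, augmentation_apply, hc, mul_comm, hcard]

lemma eq_sum_coeff_smul_single (v : MonoidAlgebra ℂ X) :
    v = ∑ x, v.coeff x • MonoidAlgebra.single x 1 := by
  classical
  apply (coords X).injective
  ext x
  simp [MonoidAlgebra.coeff_sum]

lemma tvNorm_eq (v : MonoidAlgebra ℂ X) : tvNorm v = 1 / 2 * ∑ x, ‖coords X v x‖ := rfl

lemma tvNorm_nonneg (v : MonoidAlgebra ℂ X) : 0 ≤ tvNorm v := by
  unfold tvNorm
  positivity

lemma tvNorm_zero : tvNorm (0 : MonoidAlgebra ℂ X) = 0 := by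
  simp [tvNorm]

lemma tvNorm_add_le (v w : MonoidAlgebra ℂ X) : tvNorm (v + w) ≤ tvNorm v + tvNorm w := by
  simp only [tvNorm, MonoidAlgebra.coeff_add, Finsupp.add_apply]
  rw [← mul_add, ← Finset.sum_add_distrib]
  gcongr
  exact norm_add_le _ _

lemma norm_coords_le (v : MonoidAlgebra ℂ X) : ‖coords X v‖ ≤ 2 * tvNorm v := by
  rw [tvNorm_eq]
  refine (pi_norm_le_iff_of_nonneg (by positivity)).2 fun x => ?_
  have := Finset.single_le_sum (f := fun x => ‖coords X v x‖) (fun _ _ => norm_nonneg _)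
    (Finset.mem_univ x)
  linarith

lemma tvNorm_le_norm_coords (v : MonoidAlgebra ℂ X) :
    tvNorm v ≤ Fintype.card X * ‖coords X v‖ := by
  rw [tvNorm_eq]
  have : ∑ x, ‖coords X v x‖ ≤ ∑ _x : X, ‖coords X v‖ :=
    Finset.sum_le_sum fun x _ => norm_le_pi_norm _ x
  rw [Finset.sum_const, Finset.card_univ, nsmul_eq_mul] at this
  have h0 : 0 ≤ (Fintype.card X : ℝ) * ‖coords X v‖ := by positivity
  linarith

variable {m : ℕ}

lemma worstTV_nonneg [Fintype G] (Q : Fin m → G → ℝ) (N : ℕ) : 0 ≤ worstTV X Q N :=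
  Real.iSup_nonneg fun _ => tvNorm_nonneg _

lemma tvNorm_le_worstTV [Fintype G] (Q : Fin m → G → ℝ) {N : ℕ} (x : X) (w : Fin N → Fin m) :
    tvNorm (act (toGroupAlgebra (wordConv Q w)) (MonoidAlgebra.single x 1) - uniform X) ≤
      worstTV X Q N :=
  le_ciSup (f := fun p : X × (Fin N → Fin m) => tvNorm
    (act (toGroupAlgebra (wordConv Q p.2)) (MonoidAlgebra.single p.1 1) - uniform X))
    (Set.finite_range _).bddAbove (x, w)

end Permutation

/-! ### Subrepresentations of the permutation module as unitary matrix representations -/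

section Unitarize

variable {G X : Type*} [Group G] [MulAction G X] [Fintype X]

/-- An invariant functional on a nontrivial irreducible representation vanishes. -/
lemma eq_zero_of_invariant {V : Type*} [AddCommGroup V] [Module ℂ V] {σ : Representation ℂ G V}
    (hσ : σ.IsIrreducible) (hn : ¬ σ.IsTrivial) (l : V →ₗ[ℂ] ℂ) (hl : ∀ g v, l (σ g v) = l v) :
    l = 0 := by
  let K : Subrepresentation σ := ⟨LinearMap.ker l, fun g v hv => by
    rw [LinearMap.mem_ker] at hv ⊢
    rw [hl, hv]⟩
  rcases hσ.eq_bot_or_eq_top K with h | h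
  -- An injective invariant functional would force `σ g v = v` for all `g` and `v`.
  · refine absurd ⟨fun g => ?_⟩ hn
    have hk : LinearMap.ker l = ⊥ := congrArg Subrepresentation.toSubmodule h
    ext v
    exact LinearMap.ker_eq_bot.1 hk (hl g v)
  · exact LinearMap.ker_eq_top.1 (congrArg Subrepresentation.toSubmodule h)

variable (X) in
/-- The permutation module as a Euclidean space. -/
def euclideanCoords : MonoidAlgebra ℂ X ≃ₗ[ℂ] EuclideanSpace ℂ X :=
  (coords X).trans (WithLp.linearEquiv 2 ℂ (X → ℂ)).symm

lemma euclideanCoords_apply (v : MonoidAlgebra ℂ X) (x : X) :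
    euclideanCoords X v x = v.coeff x := rfl

lemma inner_euclideanCoords_ofMulAction (g : G) (v w : MonoidAlgebra ℂ X) :
    inner ℂ (euclideanCoords X (Representation.ofMulAction ℂ G X g v))
      (euclideanCoords X (Representation.ofMulAction ℂ G X g w)) =
    inner ℂ (euclideanCoords X v) (euclideanCoords X w) := by
  simp only [PiLp.inner_apply, euclideanCoords_apply, coeff_ofMulAction_apply]
  exact Equiv.sum_comp (MulAction.toPerm g⁻¹) fun x => inner ℂ (v.coeff x) (w.coeff x)

/-- The matrix of an isometry in an orthonormal basis is unitary. -/
lemma star_toMatrixOrthonormal_mul_self {ι E : Type*} [Fintype ι] [DecidableEq ι]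
    [NormedAddCommGroup E] [InnerProductSpace ℂ E] [FiniteDimensional ℂ E]
    (b : OrthonormalBasis ι ℂ E) {T : E →ₗ[ℂ] E}
    (hT : ∀ v w, inner ℂ (T v) (T w) = inner ℂ v w) :
    star (LinearMap.toMatrixOrthonormal b T) * LinearMap.toMatrixOrthonormal b T = 1 := by
  have h : star T * T = 1 := by
    refine LinearMap.ext fun v => ext_inner_left ℂ fun w => ?_
    change inner ℂ w (LinearMap.adjoint T (T v)) = inner ℂ w v
    rw [LinearMap.adjoint_inner_right, hT]
  rw [← map_star, ← map_mul, h, map_one]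

/-- Every subrepresentation of the permutation module is the image of a unitary matrix
representation. -/
lemma exists_unitary_intertwining
    (W : Subrepresentation (Representation.ofMulAction ℂ G X)) :
    ∃ (n : ℕ) (ρ : G →* Matrix.unitaryGroup (Fin n) ℂ)
      (f : (toRep ρ).IntertwiningMap (Representation.ofMulAction ℂ G X)),
      Function.Injective f ∧ LinearMap.range f.toLinearMap = W.toSubmodule := by
  -- In Euclidean coordinates `G` permutes the entries, hence acts isometrically, and an orthonormal
  -- basis of the image of `W` yields unitary matrices.
  let E : Submodule ℂ (EuclideanSpace ℂ X) :=
    W.toSubmodule.map (euclideanCoords X).toLinearMap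
  let e : W.toSubmodule ≃ₗ[ℂ] E := (euclideanCoords X).submoduleMap W.toSubmodule
  let b := stdOrthonormalBasis ℂ E
  let T : G →* Module.End ℂ E :=
    (LinearEquiv.conjRingEquiv e : _ →* Module.End ℂ E).comp W.toRepresentation
  have hT : ∀ g (v : W.toSubmodule), T g (e v) = e (W.toRepresentation g v) := fun g v => by
    simp [T, LinearEquiv.conjRingEquiv]
  have hinner : ∀ g (v w : E), inner ℂ (T g v) (T g w) = inner ℂ v w := fun g v w => by
    obtain ⟨v, rfl⟩ := e.surjective v
    obtain ⟨w, rfl⟩ := e.surjective w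
    rw [hT, hT]
    exact inner_euclideanCoords_ofMulAction g (v : MonoidAlgebra ℂ X) w
  let D : G →* Matrix (Fin (Module.finrank ℂ E)) (Fin (Module.finrank ℂ E)) ℂ :=
    (LinearMap.toMatrixOrthonormal b : _ →* _).comp T
  have hD : ∀ g, D g ∈ Matrix.unitaryGroup (Fin (Module.finrank ℂ E)) ℂ := fun g => by
    rw [Matrix.mem_unitaryGroup_iff']
    exact star_toMatrixOrthonormal_mul_self b (hinner g)
  let ρ : G →* Matrix.unitaryGroup (Fin (Module.finrank ℂ E)) ℂ := D.codRestrict _ hD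
  let φ : (Fin (Module.finrank ℂ E) → ℂ) ≃ₗ[ℂ] W.toSubmodule :=
    b.toBasis.equivFun.symm.trans e.symm
  have hφ : ∀ g z, φ (toRep ρ g z) = W.toRepresentation g (φ z) := fun g z => by
    apply e.injective
    rw [← hT]
    obtain ⟨v, rfl⟩ := b.toBasis.equivFun.surjective z
    have h1 : toRep ρ g (b.toBasis.equivFun v) = b.toBasis.equivFun (T g v) :=
      LinearMap.toMatrix_mulVec_repr b.toBasis b.toBasis (T g) v
    rw [h1]
    simp [φ]
  refine ⟨_, ρ, (W.toSubmodule.subtype ∘ₗ φ.toLinearMap).intertwiningMap_of_isIntertwiningMap _ _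
    fun g z => ?_, ?_, ?_⟩
  · exact congrArg Subtype.val (hφ g z)
  · exact Subtype.val_injective.comp φ.injective
  · change LinearMap.range (W.toSubmodule.subtype ∘ₗ φ.toLinearMap) = _
    rw [LinearMap.range_comp_of_range_eq_top _ φ.range, Submodule.range_subtype]

/-- A representation embedded with image an atom is irreducible. -/
lemma isIrreducible_of_isAtom {V W : Type*} [AddCommGroup V] [Module ℂ V] [AddCommGroup W]
    [Module ℂ W] {σ : Representation ℂ G V} {τ : Representation ℂ G W}
    {f : σ.IntertwiningMap τ} (hf : Function.Injective f) {S : Subrepresentation τ}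
    (hS : IsAtom S) (hr : LinearMap.range f.toLinearMap = S.toSubmodule) : σ.IsIrreducible := by
  have hinj : Function.Injective f.toLinearMap := hf
  have hne : (⊤ : Submodule ℂ V) ≠ ⊥ := fun h => by
    apply hS.1
    apply Subrepresentation.toSubmodule_injective
    rw [← hr, LinearMap.range_eq_map, h, Submodule.map_bot]
    rfl
  refine { exists_pair_ne := ⟨⊥, ⊤, fun h => hne ?_⟩, eq_bot_or_eq_top := fun K => ?_ }
  · exact (congrArg Subrepresentation.toSubmodule h).symm
  · let L : Subrepresentation τ := ⟨K.toSubmodule.map f.toLinearMap, fun g w hw => by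
      obtain ⟨v, hv, rfl⟩ := hw
      exact ⟨σ g v, K.apply_mem_toSubmodule g hv, f.isIntertwining _ _ g v⟩⟩
    have hL : L ≤ S := by
      change L.toSubmodule ≤ S.toSubmodule
      rw [← hr]
      exact LinearMap.map_le_range
    rcases hS.le_iff.1 hL with h | h
    · left
      apply Subrepresentation.toSubmodule_injective
      have h' : K.toSubmodule.map f.toLinearMap = ⊥ := congrArg Subrepresentation.toSubmodule h
      exact Submodule.map_injective_of_injective hinj (h'.trans (Submodule.map_bot _).symm)
    · right
      apply Subrepresentation.toSubmodule_injective
      have h' : K.toSubmodule.map f.toLinearMap = S.toSubmodule :=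
        congrArg Subrepresentation.toSubmodule h
      rw [← hr, LinearMap.range_eq_map] at h'
      exact Submodule.map_injective_of_injective hinj h'

omit [Fintype X] in
/-- The permutation module of a finite group is spanned by its minimal subrepresentations. -/
lemma mem_of_forall_atom [Finite G] {p : MonoidAlgebra ℂ X → Prop} (h0 : p 0)
    (hadd : ∀ v w, p v → p w → p (v + w))
    (hatom : ∀ S : Subrepresentation (Representation.ofMulAction ℂ G X), IsAtom S →
      ∀ v ∈ S, p v) (v : MonoidAlgebra ℂ X) : p v := by
  let P := Representation.ofMulAction ℂ G X
  -- Maschke's theorem: the module is the sum of its simple submodules, which correspond to the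
  -- atoms among subrepresentations.
  have htop := IsSemisimpleModule.sSup_simples_eq_top (MonoidAlgebra ℂ G) P.asModule
  have hv : (P.asModuleEquiv.symm v) ∈ (⊤ : Submodule (MonoidAlgebra ℂ G) P.asModule) := trivial
  rw [← htop, sSup_eq_iSup'] at hv
  refine Submodule.iSup_induction _ (motive := fun v => p (P.asModuleEquiv v)) hv
    (fun N v hv => ?_) h0 (fun v w hv hw => hadd _ _ hv hw)
  have hN : IsAtom N.1 := isSimpleModule_iff_isAtom.1 N.2
  let o := Subrepresentation.subrepresentationSubmoduleOrderIso (ρ := P)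
  exact hatom (o.symm N.1) ((o.symm.isAtom_iff _).2 hN) v hv

end Unitarize

/-! ### Comparison of the walk with the Fourier transforms -/

section Comparison

lemma exists_norm_map_le {E F : Type*} [NormedAddCommGroup E] [NormedSpace ℂ E]
    [FiniteDimensional ℂ E] [NormedAddCommGroup F] [NormedSpace ℂ F] (T : E →ₗ[ℂ] F) :
    ∃ C, 0 ≤ C ∧ ∀ v, ‖T v‖ ≤ C * ‖v‖ :=
  ⟨‖T.toContinuousLinearMap‖, norm_nonneg _, T.toContinuousLinearMap.le_opNorm⟩

attribute [local instance] Matrix.frobeniusNormedAddCommGroup Matrix.frobeniusNormedSpace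

variable {G X : Type*} [Group G] [Fintype G] [MulAction G X] [Fintype X] {n : ℕ}
  {ρ : G →* Matrix.unitaryGroup (Fin n) ℂ}

/-- For fixed `z` the vector depends linearly on the Fourier matrix, so one constant serves all `R`,
hence all words. -/
lemma exists_tvNorm_act_le (f : (toRep ρ).IntertwiningMap (Representation.ofMulAction ℂ G X))
    (z : Fin n → ℂ) : ∃ C, 0 ≤ C ∧ ∀ R : G → ℝ,
      tvNorm (act (toGroupAlgebra R) (f z)) ≤ C * ‖fourierTransform R ρ‖ := by
  let Λ : Matrix (Fin n) (Fin n) ℂ →ₗ[ℂ] (X → ℂ) :=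
    (coords X).toLinearMap ∘ₗ f.toLinearMap ∘ₗ (Matrix.mulVecBilin ℂ ℂ).flip z
  obtain ⟨C, hC, hΛ⟩ := exists_norm_map_le Λ
  refine ⟨Fintype.card X * C, by positivity, fun R => ?_⟩
  rw [← map_fourierTransform_mulVec, mul_assoc]
  refine (tvNorm_le_norm_coords _).trans ?_
  gcongr
  exact hΛ (fourierTransform R ρ)

/-- The matrix can be recovered linearly from the deviations of the walk from uniform, through a
left inverse of the embedding. That inverse need only be linear. -/
lemma exists_norm_fourierTransform_le (hρ : IsNontrivialConstituent X ρ) :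
    ∃ C, 0 ≤ C ∧ ∀ (R : G → ℝ) (B : ℝ), 0 ≤ B →
      (∀ x : X, tvNorm (act (toGroupAlgebra R) (MonoidAlgebra.single x 1) - uniform X) ≤ B) →
      ‖fourierTransform R ρ‖ ≤ C * B := by
  obtain ⟨f, hf⟩ := hρ.appears
  obtain ⟨g, hg⟩ := f.toLinearMap.exists_leftInverse_of_injective (LinearMap.ker_eq_bot.2 hf)
  have hg' : ∀ z, g (f z) = z := fun z => LinearMap.congr_fun hg z
  have haug : ∀ z, augmentation X (f z) = 0 := fun z =>
    LinearMap.congr_fun (eq_zero_of_invariant hρ.irreducible hρ.nontrivial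
      (augmentation X ∘ₗ f.toLinearMap) fun h v => by
        change augmentation X (f (toRep ρ h v)) = augmentation X (f v)
        rw [f.isIntertwining, augmentation_ofMulAction]) z
  let c : Fin n → X → ℂ := fun j x => (f (Pi.single j 1)).coeff x
  let Λ : (X → X → ℂ) →ₗ[ℂ] Matrix (Fin n) (Fin n) ℂ :=
    { toFun := fun h => Matrix.of fun i j => ∑ x, c j x * g ((coords X).symm (h x)) i
      map_add' := fun h k => by
        ext i j
        simp [mul_add, Finset.sum_add_distrib]
      map_smul' := fun a h => by
        ext i j
        simp [Finset.mul_sum, mul_left_comm] }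
  obtain ⟨C, hC, hΛ⟩ := exists_norm_map_le Λ
  refine ⟨C * 2, by positivity, fun R B hB hR => ?_⟩
  let h : X → X → ℂ := fun x =>
    coords X (act (toGroupAlgebra R) (MonoidAlgebra.single x 1) - uniform X)
  have hh : ‖h‖ ≤ 2 * B := (pi_norm_le_iff_of_nonneg (by positivity)).2 fun x =>
    (norm_coords_le _).trans (by linarith [hR x])
  have key : fourierTransform R ρ = Λ h := by
    ext i j
    have h1 : (fourierTransform R ρ).mulVec (Pi.single j 1) =
        ∑ x, c j x • g (act (toGroupAlgebra R) (MonoidAlgebra.single x 1) - uniform X) := by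
      have h2 : act (toGroupAlgebra R) (f (Pi.single j 1)) = ∑ x, c j x •
          (act (toGroupAlgebra R) (MonoidAlgebra.single x 1) - uniform X) := by
        -- Zero augmentation: subtracting `uniform X` from every term leaves the combination
        -- unchanged.
        have h3 : ∑ x, c j x = 0 := by
          rw [← augmentation_apply, haug]
        conv_lhs => rw [eq_sum_coeff_smul_single (f (Pi.single j 1))]
        simp only [smul_sub, Finset.sum_sub_distrib]
        rw [← Finset.sum_smul, h3, zero_smul, sub_zero]
        simp only [act, map_sum, map_smul]
        rfl
      rw [← hg' ((fourierTransform R ρ).mulVec (Pi.single j 1)),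
        map_fourierTransform_mulVec, h2]
      simp only [map_sum, map_smul]
    have h4 := congrFun h1 i
    rw [Matrix.mulVec_single_one] at h4
    simpa [Λ, h, Finset.sum_apply] using h4
  rw [key, mul_assoc]
  exact (hΛ h).trans (mul_le_mul_of_nonneg_left hh hC)

variable {m : ℕ} [NeZero m] {Q : Fin m → G → ℝ}

/-- The radius of a constituent is a lower bound for the growth of the worst-case distance. -/
lemma exists_pow_le_worstTV {r : ℝ} (hr : r ∈ constituentRadii X Q) :
    0 ≤ r ∧ ∃ C, ∀ N, N ≠ 0 → r ^ N ≤ C * worstTV X Q N := by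
  obtain ⟨n, ρ, hρ, rfl⟩ := hr
  obtain ⟨h0, -, hpow⟩ := jsr_spec fun i => fourierTransform (Q i) ρ
  obtain ⟨C, hC, hCR⟩ := exists_norm_fourierTransform_le hρ
  refine ⟨h0, C, fun N hN => (hpow N hN).trans (ciSup_le fun w => ?_)⟩
  rw [← fourierTransform_wordConv]
  exact hCR _ _ (worstTV_nonneg Q N) fun x => tvNorm_le_worstTV Q x w

variable (Q) in
/-- The projection of `v` to the elements of augmentation zero decays along words, at any rate
larger than finitely many constituent radii. -/
def DecaysAtRadii (v : MonoidAlgebra ℂ X) : Prop :=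
  ∃ F : Finset ℝ, ↑F ⊆ constituentRadii X Q ∧ ∀ s, 0 < s → (∀ r ∈ F, r < s) →
    ∃ C, ∀ᶠ N in atTop, ∀ w : Fin N → Fin m,
      tvNorm (act (toGroupAlgebra (wordConv Q w)) (v - augmentation X v • uniform X)) ≤ C * s ^ N

omit [NeZero m] in
lemma decaysAtRadii_of_fixed {v : MonoidAlgebra ℂ X} (hv : v = augmentation X v • uniform X) :
    DecaysAtRadii Q v := by
  refine ⟨∅, by simp, fun s hs _ => ⟨0, Eventually.of_forall fun N w => ?_⟩⟩
  rw [sub_eq_zero.2 hv, act, map_zero, tvNorm_zero, zero_mul]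

omit [NeZero m] in
lemma DecaysAtRadii.add {v v' : MonoidAlgebra ℂ X} (hv : DecaysAtRadii Q v)
    (hv' : DecaysAtRadii Q v') : DecaysAtRadii Q (v + v') := by
  classical
  obtain ⟨F, hF, h⟩ := hv
  obtain ⟨F', hF', h'⟩ := hv'
  refine ⟨F ∪ F', by simp [hF, hF'], fun s hs hsF => ?_⟩
  obtain ⟨C, hC⟩ := h s hs fun r hr => hsF r (Finset.mem_union_left _ hr)
  obtain ⟨C', hC'⟩ := h' s hs fun r hr => hsF r (Finset.mem_union_right _ hr)
  refine ⟨C + C', ?_⟩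
  filter_upwards [hC, hC'] with N hN hN' w
  have : v + v' - augmentation X (v + v') • uniform X =
      (v - augmentation X v • uniform X) + (v' - augmentation X v' • uniform X) := by
    rw [map_add, add_smul]
    abel
  rw [this, act, map_add, add_mul]
  exact (tvNorm_add_le _ _).trans (add_le_add (hN w) (hN' w))

/-- The property is additive, so irreducible subrepresentations suffice. Since each vector carries
its own finite set of radii, finiteness of `constituentRadii` is never needed. -/
lemma decaysAtRadii [MulAction.IsPretransitive G X] (v : MonoidAlgebra ℂ X) :
    DecaysAtRadii Q v := by
  refine mem_of_forall_atom (G := G) (decaysAtRadii_of_fixed (by simp))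
    (fun v w hv hw => hv.add hw) (fun S hS v hv => ?_) v
  obtain ⟨n, ρ, f, hf, hr⟩ := exists_unitary_intertwining S
  have hirr := isIrreducible_of_isAtom hf hS hr
  have hv' : v ∈ LinearMap.range f.toLinearMap := by
    rw [hr]
    exact hv
  obtain ⟨z, rfl⟩ := hv'
  change DecaysAtRadii Q (f z)
  by_cases htriv : (toRep ρ).IsTrivial
  · refine decaysAtRadii_of_fixed (eq_augmentation_smul_uniform (G := G) fun g => ?_)
    rw [← f.isIntertwining, Representation.isTrivial_apply]
  · have haug : augmentation X (f z) = 0 :=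
      LinearMap.congr_fun (eq_zero_of_invariant hirr htriv
        (augmentation X ∘ₗ f.toLinearMap) fun h v => by
          change augmentation X (f (toRep ρ h v)) = augmentation X (f v)
          rw [f.isIntertwining, augmentation_ofMulAction]) z
    obtain ⟨C, hC, hCR⟩ := exists_tvNorm_act_le f z
    refine ⟨{jsr fun i => fourierTransform (Q i) ρ}, ?_, fun s hs hsF => ⟨C, ?_⟩⟩
    · rw [Finset.coe_singleton, Set.singleton_subset_iff]
      exact ⟨n, ρ, ⟨hirr, htriv, f, hf⟩, rfl⟩
    · filter_upwards [maxNorm_le_pow_of_jsr_lt _ (hsF _ (Finset.mem_singleton_self _))]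
        with N hN w
      rw [haug, zero_smul, sub_zero]
      refine (hCR _).trans (mul_le_mul_of_nonneg_left (le_trans ?_ hN) hC)
      rw [fourierTransform_wordConv]
      exact norm_prod_le_maxNorm (fun i => fourierTransform (Q i) ρ) w

/-- The worst-case distance grows at most at any rate larger than some `M`, which is `0` or the
radius of a constituent. -/
lemma exists_worstTV_le [Nonempty X] [MulAction.IsPretransitive G X]
    (hQ : ∀ i, ∑ g, Q i g = 1) :
    ∃ M, 0 ≤ M ∧ (M = 0 ∨ M ∈ constituentRadii X Q) ∧
      ∀ s, M < s → ∃ C, ∀ᶠ N in atTop, worstTV X Q N ≤ C * s ^ N := by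
  classical
  choose F hF hdecay using fun x : X => decaysAtRadii (Q := Q) (MonoidAlgebra.single x (1 : ℂ))
  -- The finitely many basis vectors need only finitely many radii; inserting `0` keeps the maximum
  -- defined when there are none.
  let K : Finset ℝ := insert 0 (Finset.univ.biUnion F)
  have hK : ∀ r ∈ K, r = 0 ∨ r ∈ constituentRadii X Q := fun r hr => by
    rcases Finset.mem_insert.1 hr with h | h
    · exact Or.inl h
    · obtain ⟨x, -, hx⟩ := Finset.mem_biUnion.1 h
      exact Or.inr (hF x hx)
  have hne : K.Nonempty := ⟨0, Finset.mem_insert_self _ _⟩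
  have hM : 0 ≤ K.max' hne := K.le_max' 0 (Finset.mem_insert_self _ _)
  refine ⟨K.max' hne, hM, hK _ (K.max'_mem hne), fun s hs => ?_⟩
  have hs0 := hM.trans_lt hs
  choose C hC using fun x => hdecay x s hs0 fun r hr => (K.le_max' r
    (Finset.mem_insert_of_mem (Finset.mem_biUnion.2 ⟨x, Finset.mem_univ x, hr⟩))).trans_lt hs
  refine ⟨∑ x, |C x|, ?_⟩
  filter_upwards [eventually_all.2 hC] with N hN
  refine ciSup_le fun p => ?_
  have h1 : augmentation X (MonoidAlgebra.single p.1 (1 : ℂ)) = 1 := by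
    simp [augmentation_apply, Finsupp.single_apply]
  have h2 := hN p.1 p.2
  have h3 := act_uniform (X := X) (sum_wordConv hQ p.2)
  rw [h1, one_smul, act, map_sub, ← act, ← act, h3] at h2
  refine h2.trans ?_
  gcongr
  exact (le_abs_self _).trans
    (Finset.single_le_sum (f := fun x => |C x|) (fun _ _ => abs_nonneg _) (Finset.mem_univ _))

end Comparison

end SwitchedWalk

end

/-! ### Conclusion: the rate and the mixing criterion. -/

theorem mainTheorem2 {G X : Type*} [Group G] [Fintype G] [Fintype X] [Nonempty X]
    [MulAction G X] [MulAction.IsPretransitive G X] {m : ℕ} (hm : 1 ≤ m)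
    (Q : Fin m → G → ℝ) (hQ : ∀ i, Q i ∈ stdSimplex ℝ G) :
    -- the limits that define the joint spectral radii exist
    (∀ (n : ℕ) (ρ : G →* Matrix.unitaryGroup (Fin n) ℂ),
      SwitchedWalk.IsNontrivialConstituent X ρ →
        Filter.Tendsto
          (SwitchedWalk.jsrSeq fun i => SwitchedWalk.fourierTransform (Q i) ρ) Filter.atTop
          (nhds (SwitchedWalk.jsr fun i => SwitchedWalk.fourierTransform (Q i) ρ))) ∧
    -- the Fourier joint spectral radius is an attained maximum
    ((SwitchedWalk.constituentRadii X Q).Nonempty →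
      IsGreatest (SwitchedWalk.constituentRadii X Q) (SwitchedWalk.fourierJSR X Q)) ∧
    -- it is the asymptotic worst-case rate
    Filter.Tendsto (fun N : ℕ => SwitchedWalk.worstTV X Q N ^ (1 / (N : ℝ))) Filter.atTop
      (nhds (SwitchedWalk.fourierJSR X Q)) ∧
    -- it decides adversarial mixing
    (SwitchedWalk.AdversarialMixing X Q ↔ SwitchedWalk.fourierJSR X Q < 1) := by
  have : NeZero m := ⟨by omega⟩
  obtain ⟨M, hM, hMmem, hup⟩ := SwitchedWalk.exists_worstTV_le (X := X) fun i => (hQ i).2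
  have hx := SwitchedWalk.worstTV_nonneg (X := X) Q
  have hlim : Tendsto (fun N : ℕ => SwitchedWalk.worstTV X Q N ^ (1 / (N : ℝ))) atTop (𝓝 M) :=
    SwitchedWalk.tendsto_rpow_one_div_of_bounds hx hM
      (hMmem.imp_right fun h => (SwitchedWalk.exists_pow_le_worstTV h).2) hup
  have hgreat : (SwitchedWalk.constituentRadii X Q).Nonempty →
      IsGreatest (SwitchedWalk.constituentRadii X Q) M := by
    have hle : ∀ r ∈ SwitchedWalk.constituentRadii X Q, r ≤ M := fun r hr => by
      obtain ⟨hr0, C, hC⟩ := SwitchedWalk.exists_pow_le_worstTV hr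
      exact SwitchedWalk.le_of_pow_le_of_tendsto_rpow_one_div hx hr0 hC hlim
    rintro ⟨r, hr⟩
    refine ⟨?_, hle⟩
    rcases hMmem with rfl | h
    -- If `M = 0`, any existing radius lies between `0` and `M`, so `0` is itself a radius.
    · rwa [← le_antisymm (hle r hr) (SwitchedWalk.exists_pow_le_worstTV hr).1]
    · exact h
  have hjsr : SwitchedWalk.fourierJSR X Q = M := by
    rcases (SwitchedWalk.constituentRadii X Q).eq_empty_or_nonempty with h | h
    · rw [SwitchedWalk.fourierJSR, h, Real.sSup_empty]
      simpa [h, eq_comm] using hMmem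
    · exact (hgreat h).csSup_eq
  rw [hjsr]
  refine ⟨fun n ρ _ => (SwitchedWalk.jsr_spec _).2.1, hgreat, hlim, fun hmix => ?_, fun hlt => ?_⟩
  · rcases hMmem with rfl | h
    · exact one_pos
    obtain ⟨-, C, hC⟩ := SwitchedWalk.exists_pow_le_worstTV h
    -- The limit of the roots cannot exclude `M = 1`; the bound `M ^ N ≤ C * worstTV` can, as its
    -- right side tends to `0`.
    by_contra! h1
    have h2 : Tendsto (fun N => C * SwitchedWalk.worstTV X Q N) atTop (𝓝 (C * 0)) :=
      Tendsto.const_mul C hmix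
    rw [mul_zero] at h2
    obtain ⟨N, hN, hN0⟩ := ((h2.eventually_lt_const one_pos).and (eventually_ne_atTop 0)).exists
    exact absurd ((one_le_pow₀ h1).trans (hC N hN0)) hN.not_ge
  · obtain ⟨s, hs, hs1⟩ := exists_between hlt
    obtain ⟨C, hC⟩ := hup s hs
    have h2 : Tendsto (fun N => C * s ^ N) atTop (𝓝 (C * 0)) :=
      (tendsto_pow_atTop_nhds_zero_of_lt_one (hM.trans hs.le) hs1).const_mul C
    rw [mul_zero] at h2
    exact squeeze_zero' (Eventually.of_forall hx) hC h2
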